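/- Let $B\subseteq\mathbb R^n$ be open and connected, let $T_B=\mathbb R^n+iB\subseteq\mathbb C^n$ be the tube over $B$, and let $\psi:B\to\mathbb R$ be continuous. For $0<p<\infty$ and $0<s\le\infty$, let $A^{p,s}(B,\psi)$ be the set of functions $F$ holomorphic in $T_B$ with $\|F\|_{A^{p,s}(B,\psi)}<\infty$, where $$\|F\|_{A^{p,s}(B,\psi)}=\left(\int_B\left(\int_{\mathbb R^n}|F(x+iy)e^{-2\pi\psi(y)}|^p\,dx\right)^s dy\right)^{\frac1{sp}}\quad (s<\infty),$$ $$\|F\|_{A^{p,\infty}(B,\psi)}=\sup_{y\in B}\, e^{-2\pi\psi(y)}\left(\int_{\mathbb R^n}|F(x+iy)|^p\,dx\right)^{\frac1p}.$$ **Theorem 2.** Let $0<p<1$, $0<s\le\infty$ and $F\in A^{p,s}(B,\psi)$. Then there exists a continuous function $f:\mathbb R^n\to\mathbb C$ such that $t\mapsto f(t)e^{-2\pi y\cdot t}$ belongs to $L^1(\mathbb R^n)$ for every $y\in B$, and $$F(z)=\int_{\mathbb R^n}f(t)e^{2\pi i\,t\cdot z}\,dt\qquad\text{for all } z\in T_B,$$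 where $t\cdot z=t_1z_1+\cdots+t_nz_n$. -/

import Mathlib

open MeasureTheory
open scoped ENNReal

noncomputable section

namespace TubeBergman

/-- The point `x + i y` of `ℂⁿ`, for `x y ∈ ℝⁿ`. -/
def tubePoint {n : ℕ} (x y : EuclideanSpace ℝ (Fin n)) : EuclideanSpace ℂ (Fin n) :=
  WithLp.toLp 2 fun k => (x k : ℂ) + (y k : ℂ) * Complex.I

/-- The coordinatewise imaginary part of a point of `ℂⁿ`. -/
def imPart {n : ℕ} (z : EuclideanSpace ℂ (Fin n)) : EuclideanSpace ℝ (Fin n) :=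
  WithLp.toLp 2 fun k => (z k).im

/-- The tube `T_B = ℝⁿ + i B ⊆ ℂⁿ` over `B ⊆ ℝⁿ`. -/
def tube {n : ℕ} (B : Set (EuclideanSpace ℝ (Fin n))) : Set (EuclideanSpace ℂ (Fin n)) :=
  {z | imPart z ∈ B}

/-- The bilinear product `t · z = t₁ z₁ + ⋯ + tₙ zₙ` of `t ∈ ℝⁿ` and `z ∈ ℂⁿ`. -/
def bilin {n : ℕ} (t : EuclideanSpace ℝ (Fin n)) (z : EuclideanSpace ℂ (Fin n)) : ℂ :=
  ∑ k, (t k : ℂ) * z k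

/-- The quantity `‖F‖_{A^{p,s}(B,ψ)} ∈ [0,∞]`, for finite `p > 0` and `0 < s ≤ ∞`. For `s < ∞` it is
`(∫_B (∫_{ℝⁿ} |F(x+iy) e^{-2πψ(y)}|^p dx)^s dy)^{1/(sp)}`, and for `s = ∞` it is
`sup_{y ∈ B} e^{-2πψ(y)} (∫_{ℝⁿ} |F(x+iy)|^p dx)^{1/p}`. -/
def bergmanNorm {n : ℕ} (B : Set (EuclideanSpace ℝ (Fin n))) (ψ : EuclideanSpace ℝ (Fin n) → ℝ)
    (p : ℝ) (s : ℝ≥0∞) (F : EuclideanSpace ℂ (Fin n) → ℂ) : ℝ≥0∞ :=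
  open Classical in
  if s = ∞ then
    ⨆ y ∈ B, ENNReal.ofReal (Real.exp (-2 * Real.pi * ψ y)) *
      (∫⁻ x : EuclideanSpace ℝ (Fin n), ‖F (tubePoint x y)‖ₑ ^ p) ^ (1 / p)
  else
    (∫⁻ y in B, (∫⁻ x : EuclideanSpace ℝ (Fin n),
      ‖F (tubePoint x y) * (Real.exp (-2 * Real.pi * ψ y) : ℂ)‖ₑ ^ p) ^ s.toReal) ^
        (1 / (s.toReal * p))

/-- The weighted space `A^{p,s}(B,ψ)`: functions holomorphic in `T_B` with
`‖F‖_{A^{p,s}(B,ψ)} < ∞`. Only the values of `F` on `T_B` matter. -/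
def bergmanSpace {n : ℕ} (B : Set (EuclideanSpace ℝ (Fin n))) (ψ : EuclideanSpace ℝ (Fin n) → ℝ)
    (p : ℝ) (s : ℝ≥0∞) : Set (EuclideanSpace ℂ (Fin n) → ℂ) :=
  {F | DifferentiableOn ℂ F (tube B) ∧ bergmanNorm B ψ p s F < ∞}

end TubeBergman

end

namespace TubeBergman

open Metric Filter Set Topology FourierTransform

variable {n : ℕ}

local notation "𝔼" n => EuclideanSpace ℝ (Fin n)

/-! With `σ = min 1 s` (`σ = 1` for `s = ∞`), finiteness of the norm and local boundedness of `ψ`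
make `y ↦ (∫ |F(x+iy)|^p dx)^σ` locally integrable on `B` (`exists_lintegral_rpow_lt_top`). The
power `|F|^(pσ)` has the sub-mean value property on balls of `ℂⁿ`, so `F` is bounded on the tube
over a small ball around each point of `B` (`exists_norm_le_of_lintegral_rpow_lt_top`). Since `p <
1`, `|F| ≤ M^(1-p) |F|^p` on such a tube, and slices with finite `p`-integral are integrable; their
heights `y` form a dense set `G ⊆ B`.

For `y ∈ G` put `f(t) = e^(2π y·t) (F(· + iy))^(t)`. Shifting the contour shows that this does not
depend on `y` (`exp_mul_fourier_eq`); as `F` is merely bounded, the shift is done after multiplying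
by `exp(-ε z·z)`, and then `ε → 0`. Hence `|f(t)| ≤ C_y e^(2π y·t)` for all `y ∈ G`. Because `B` is
open, `y` can be moved against the direction of `t`, which gains a factor `e^(-c|t|)` at every point
of `B` (`exists_norm_le_exp_sub`). The Laplace integral thus converges on all of `T_B`; it equals
`F` over `G` by Fourier inversion, and over `B` by continuity. -/

/-! ### Sub-mean value property in one variable -/

/-- The power `‖f‖ ^ q` of an analytic function has the sub-mean value property, for
all `q > 0`. -/
theorem norm_rpow_le_circleAverage {f : ℂ → ℂ} {q : ℝ} (hq : 0 < q)
    (hf : AnalyticOnNhd ℂ f (closedBall 0 1)) :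
    ‖f 0‖ ^ q ≤ Real.circleAverage (fun z => ‖f z‖ ^ q) 0 1 := by
  have hfa : AnalyticOnNhd ℂ f (closedBall 0 |1|) := by simpa using hf
  have hsub : sphere (0 : ℂ) |1| ⊆ closedBall 0 1 := by
    simpa using (sphere_subset_closedBall : sphere (0 : ℂ) 1 ⊆ _)
  have hint : CircleIntegrable (fun z => ‖f z‖ ^ q) 0 1 := by
    apply ContinuousOn.circleIntegrable'
    exact ((hf.continuousOn.mono hsub).norm.rpow_const fun _ _ => Or.inr hq.le)
  by_cases h0 : f 0 = 0
  · rw [h0, norm_zero, Real.zero_rpow hq.ne']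
    exact Real.circleAverage_nonneg_of_nonneg fun _ _ => by positivity
  set a := ‖f 0‖ with ha
  have ha0 : 0 < a := norm_pos_iff.2 h0
  have hlogint : CircleIntegrable (fun z => Real.log ‖f z‖) 0 1 :=
    (hfa.mono sphere_subset_closedBall).meromorphicOn.circleIntegrable_log_norm
  -- Jensen's formula: each zero `u` in the closed disc contributes `log (1 / |u|) ≥ 0`.
  have hjensen : Real.log a ≤ Real.circleAverage (fun z => Real.log ‖f z‖) 0 1 := by
    rw [hfa.circleAverage_log_norm one_ne_zero h0]
    have : 0 ≤ ∑ᶠ u, (MeromorphicOn.divisor f (closedBall 0 |1|) u : ℝ) *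
        Real.log (1 * ‖(0 : ℂ) - u‖⁻¹) := by
      apply finsum_nonneg
      intro u
      by_cases hu : u ∈ closedBall (0 : ℂ) |1|
      · apply mul_nonneg (mod_cast MeromorphicOn.AnalyticOnNhd.divisor_nonneg hfa u)
        have hu' : ‖u‖ ≤ 1 := by simpa using hu
        rw [one_mul, zero_sub, norm_neg, Real.log_inv, neg_nonneg]
        exact Real.log_nonpos (norm_nonneg _) hu'
      · simp [Function.locallyFinsuppWithin.apply_eq_zero_of_notMem _ hu]
    linarith
  -- Zeros on the circle itself are allowed, but since `f 0 ≠ 0` they are isolated and hence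
  -- negligible.
  have hne : ∀ᶠ z in codiscreteWithin (sphere (0 : ℂ) |1|), f z ≠ 0 := by
    apply Filter.codiscreteWithin_mono (U := closedBall (0 : ℂ) 1) hsub
    exact hf.preimage_zero_mem_codiscreteWithin (x := 0) h0 (by simp)
      ⟨⟨0, by simp⟩, (convex_closedBall _ _).isPreconnected⟩
  have hae : ∀ᵐ θ ∂volume.restrict (uIoc 0 (2 * Real.pi)), f (circleMap 0 1 θ) ≠ 0 := by
    apply ae_restrict_le_codiscreteWithin measurableSet_uIoc
    exact codiscreteWithin_mono (by tauto) (circleMap_preimage_codiscrete one_ne_zero hne)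
  -- `u ^ q` is a convex function of `log u`; this is its tangent line at `log a`. Integrating it
  -- turns the bound on the mean of `log ‖f‖` into one on the mean of `‖f‖ ^ q`.
  have htan : ∀ u : ℝ, 0 < u → a ^ q + a ^ q * q * (Real.log u - Real.log a) ≤ u ^ q := by
    intro u hu
    have h1 : u ^ q = a ^ q * Real.exp (q * (Real.log u - Real.log a)) := by
      rw [Real.rpow_def_of_pos hu, Real.rpow_def_of_pos ha0, ← Real.exp_add]
      congr 1; ring
    rw [h1]
    nlinarith [Real.add_one_le_exp (q * (Real.log u - Real.log a)), Real.rpow_pos_of_pos ha0 q]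
  have hmono : ∫ θ in (0)..(2 * Real.pi),
      (a ^ q + a ^ q * q * (Real.log ‖f (circleMap 0 1 θ)‖ - Real.log a)) ≤
      ∫ θ in (0)..(2 * Real.pi), ‖f (circleMap 0 1 θ)‖ ^ q := by
    apply intervalIntegral.integral_mono_ae_restrict Real.two_pi_pos.le
    · exact intervalIntegrable_const.add
        ((IntervalIntegrable.sub hlogint intervalIntegrable_const).const_mul _)
    · exact hint
    · rw [uIoc_of_le Real.two_pi_pos.le] at hae
      rw [Filter.EventuallyLE, ← restrict_Ioc_eq_restrict_Icc]
      filter_upwards [hae] with θ hθ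
      exact htan _ (norm_pos_iff.2 hθ)
  have hlogint' : IntervalIntegrable (fun θ => Real.log ‖f (circleMap 0 1 θ)‖) volume 0
    (2 * Real.pi) := hlogint
  rw [intervalIntegral.integral_add intervalIntegrable_const
    ((hlogint'.sub intervalIntegrable_const).const_mul _),
    intervalIntegral.integral_const_mul, intervalIntegral.integral_sub hlogint'
      intervalIntegrable_const] at hmono
  simp only [intervalIntegral.integral_const, sub_zero, smul_eq_mul] at hmono
  unfold Real.circleAverage at hjensen ⊢
  simp only [smul_eq_mul] at hjensen ⊢
  have hπ := Real.two_pi_pos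
  rw [inv_mul_eq_div, le_div_iff₀ hπ] at hjensen ⊢
  have : 0 ≤ a ^ q * q := by positivity
  nlinarith

theorem enorm_rpow_mul_le_lintegral {f : ℂ → ℂ} {q : ℝ} (hq : 0 < q)
    (hf : AnalyticOnNhd ℂ f (closedBall 0 1)) :
    ‖f 0‖ₑ ^ q * ENNReal.ofReal (2 * Real.pi) ≤
      ∫⁻ θ in Ioc 0 (2 * Real.pi), ‖f (circleMap 0 1 θ)‖ₑ ^ q := by
  have h := norm_rpow_le_circleAverage hq hf
  unfold Real.circleAverage at h
  rw [smul_eq_mul, inv_mul_eq_div, le_div_iff₀ Real.two_pi_pos,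
    intervalIntegral.integral_of_le Real.two_pi_pos.le] at h
  have hc : Continuous fun θ => f (circleMap 0 1 θ) := by
    rw [← continuousOn_univ]
    refine hf.continuousOn.comp (continuous_circleMap 0 1).continuousOn fun θ _ => ?_
    exact circleMap_mem_closedBall 0 zero_le_one θ
  have hint : IntegrableOn (fun θ => ‖f (circleMap 0 1 θ)‖ ^ q) (Ioc 0 (2 * Real.pi)) :=
    ((hc.norm.rpow_const fun _ => Or.inr hq.le).integrableOn_Icc).mono_set Ioc_subset_Icc_self
  have key : ∀ z : ℂ, ‖z‖ₑ ^ q = ENNReal.ofReal (‖z‖ ^ q) := fun z => by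
    rw [← ofReal_norm, ENNReal.ofReal_rpow_of_nonneg (norm_nonneg _) hq.le]
  simp only [key]
  rw [← ENNReal.ofReal_mul (by positivity), ← ofReal_integral_eq_lintegral_ofReal hint
    (ae_of_all _ fun _ => by positivity)]
  exact ENNReal.ofReal_le_ofReal h

/-! ### Real coordinates on the tube -/

theorem continuous_tubePoint :
    Continuous fun w : (𝔼 n) × (𝔼 n) => tubePoint w.1 w.2 := by
  unfold tubePoint
  fun_prop

theorem continuous_imPart : Continuous (imPart : EuclideanSpace ℂ (Fin n) → 𝔼 n) := by
  unfold imPart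
  fun_prop

@[simp] theorem imPart_tubePoint (x y : 𝔼 n) : imPart (tubePoint x y) = y := by
  ext k
  simp [imPart, tubePoint]

theorem tubePoint_mem_tube {B : Set (𝔼 n)} {x y : 𝔼 n} : tubePoint x y ∈ tube B ↔ y ∈ B := by
  simp [tube]

theorem isOpen_tube {B : Set (𝔼 n)} (hB : IsOpen B) : IsOpen (tube B) :=
  hB.preimage continuous_imPart

theorem exists_tubePoint_eq (z : EuclideanSpace ℂ (Fin n)) :
    ∃ x, tubePoint x (imPart z) = z := by
  refine ⟨WithLp.toLp 2 fun k => (z k).re, ?_⟩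
  ext k
  simp [tubePoint, imPart, Complex.re_add_im]

theorem tubePoint_add_smul (x y a b : 𝔼 n) (w : ℂ) :
    tubePoint x y + w • tubePoint a b =
      tubePoint (x + (w.re • a - w.im • b)) (y + (w.im • a + w.re • b)) := by
  ext k
  apply Complex.ext
  · simp [tubePoint]
  · simp [tubePoint]
    ring

/-! ### Rotations and the sub-mean value property on balls of `ℂⁿ` -/

/-- The multiplication by `exp (i θ)` on `ℂⁿ`, in the coordinates `(x, y)` of `x + i y`. -/
noncomputable def rotation (n : ℕ) (θ : ℝ) : ((𝔼 n) × (𝔼 n)) →ₗ[ℝ] (𝔼 n) × (𝔼 n) :=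
  LinearMap.prod (Real.cos θ • LinearMap.fst ℝ _ _ - Real.sin θ • LinearMap.snd ℝ _ _)
    (Real.sin θ • LinearMap.fst ℝ _ _ + Real.cos θ • LinearMap.snd ℝ _ _)

theorem rotation_apply (θ : ℝ) (w : (𝔼 n) × (𝔼 n)) :
    rotation n θ w = (Real.cos θ • w.1 - Real.sin θ • w.2, Real.sin θ • w.1 + Real.cos θ • w.2) :=
  rfl

theorem rotation_neg_comp (θ : ℝ) : rotation n (-θ) ∘ₗ rotation n θ = LinearMap.id := by
  have h := Real.sin_sq_add_cos_sq θ
  ext w k <;> simp [rotation_apply] <;> first | ring1 | linear_combination (w k) * h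

/-- Complex conjugation `J` conjugates the rotation by `θ` into its inverse, so both have the same
determinant, while the product of the determinants is `1`. -/
theorem det_rotation_sq (θ : ℝ) : LinearMap.det (rotation n θ) ^ 2 = 1 := by
  let J : ((𝔼 n) × (𝔼 n)) →ₗ[ℝ] (𝔼 n) × (𝔼 n) :=
    (LinearMap.fst ℝ _ _).prod (-LinearMap.snd ℝ _ _)
  have hJ : J ∘ₗ J = LinearMap.id := by
    ext w k <;> simp [J]
  have hJR : J ∘ₗ rotation n θ ∘ₗ J = rotation n (-θ) := by
    ext w k <;> simp [J, rotation_apply]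
  have h1 := congrArg LinearMap.det (rotation_neg_comp (n := n) θ)
  have h2 := congrArg LinearMap.det hJ
  rw [← hJR] at h1
  simp only [LinearMap.det_comp, LinearMap.det_id] at h1 h2
  linear_combination h1 - LinearMap.det (rotation n θ) ^ 2 * h2

theorem measurePreserving_rotation (θ : ℝ) :
    MeasurePreserving (rotation n θ) volume volume := by
  refine ⟨(LinearMap.continuous_of_finiteDimensional _).measurable, ?_⟩
  have h := det_rotation_sq (n := n) θ
  have h0 : LinearMap.det (rotation n θ) ≠ 0 := by
    intro h'; simp [h'] at h
  have habs : |(LinearMap.det (rotation n θ))⁻¹| = 1 := by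
    rcases sq_eq_one_iff.1 h with h | h <;> simp [h]
  have : (volume : Measure ((𝔼 n) × (𝔼 n))).IsAddHaarMeasure := by
    rw [Measure.volume_eq_prod]
    infer_instance
  rw [Measure.map_linearMap_addHaar_eq_smul_addHaar _ h0, habs]
  simp

theorem norm_sq_rotation (θ : ℝ) (w : (𝔼 n) × (𝔼 n)) :
    ‖(rotation n θ w).1‖ ^ 2 + ‖(rotation n θ w).2‖ ^ 2 = ‖w.1‖ ^ 2 + ‖w.2‖ ^ 2 := by
  rw [rotation_apply]
  simp only [norm_sub_sq_real, norm_add_sq_real, norm_smul, inner_smul_left, inner_smul_right,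
    mul_pow, Real.norm_eq_abs, sq_abs]
  have h := Real.sin_sq_add_cos_sq θ
  simp
  linear_combination (‖w.1‖ ^ 2 + ‖w.2‖ ^ 2) * h

/-- The Euclidean ball of `ℂⁿ`, in the coordinates `(x, y)` of `x + i y`. -/
def complexBall (n : ℕ) (r : ℝ) : Set ((𝔼 n) × (𝔼 n)) := {w | ‖w.1‖ ^ 2 + ‖w.2‖ ^ 2 < r ^ 2}

theorem isOpen_complexBall (r : ℝ) : IsOpen (complexBall n r) :=
  isOpen_lt (by fun_prop) continuous_const

theorem complexBall_subset {r : ℝ} (hr : 0 < r) : complexBall n r ⊆ ball 0 r ×ˢ ball 0 r := by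
  intro w hw
  have hw : ‖w.1‖ ^ 2 + ‖w.2‖ ^ 2 < r ^ 2 := hw
  simp only [mem_prod, mem_ball_zero_iff]
  exact ⟨lt_of_pow_lt_pow_left₀ 2 hr.le (by nlinarith [sq_nonneg ‖w.2‖]),
    lt_of_pow_lt_pow_left₀ 2 hr.le (by nlinarith [sq_nonneg ‖w.1‖])⟩

theorem volume_complexBall_pos {r : ℝ} (hr : 0 < r) : 0 < volume (complexBall n r) :=
  (isOpen_complexBall r).measure_pos _ ⟨0, by simp [complexBall, hr]⟩

theorem volume_complexBall_lt_top {r : ℝ} (hr : 0 < r) : volume (complexBall n r) < ∞ :=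
  (measure_mono (complexBall_subset hr)).trans_lt
    ((isBounded_ball.prod isBounded_ball).measure_lt_top)

/-- Sub-mean value property of `‖F‖ ^ q` over balls of `ℂⁿ`. -/
theorem enorm_rpow_mul_volume_le {B : Set (𝔼 n)} (hB : IsOpen B)
    {F : EuclideanSpace ℂ (Fin n) → ℂ} (hF : DifferentiableOn ℂ F (tube B)) {q : ℝ} (hq : 0 < q)
    {r : ℝ} (hr : 0 < r) (x₀ : 𝔼 n) {y₀ : 𝔼 n} (hy : ball y₀ r ⊆ B) :
    ‖F (tubePoint x₀ y₀)‖ₑ ^ q * volume (complexBall n r) ≤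
      ∫⁻ w in complexBall n r, ‖F (tubePoint (x₀ + w.1) (y₀ + w.2))‖ₑ ^ q := by
  set D := complexBall n r with hD
  have hDm : MeasurableSet D := (isOpen_complexBall r).measurableSet
  let U : Set ((𝔼 n) × (𝔼 n)) := {w | y₀ + w.2 ∈ B}
  have hU : IsOpen U := hB.preimage (by fun_prop)
  -- Cutting off outside the tube makes the integrand globally measurable, as the change of
  -- variables and Tonelli require.
  let u : (𝔼 n) × (𝔼 n) → ℝ≥0∞ :=
    U.indicator fun w => ‖F (tubePoint (x₀ + w.1) (y₀ + w.2))‖ₑ ^ q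
  have hu : Measurable u := by
    have h1 : ContinuousOn (fun w : (𝔼 n) × (𝔼 n) => F (tubePoint (x₀ + w.1) (y₀ + w.2))) U := by
      refine hF.continuousOn.comp (Continuous.continuousOn ?_) fun w hw => tubePoint_mem_tube.2 hw
      exact continuous_tubePoint.comp
        (by fun_prop : Continuous fun w : (𝔼 n) × (𝔼 n) => (x₀ + w.1, y₀ + w.2))
    classical
    simp only [u, ← piecewise_eq_indicator]
    exact (ENNReal.continuous_rpow_const.comp_continuousOn h1.enorm).measurable_piecewise
      continuousOn_const hU.measurableSet
  have huD : ∀ w ∈ D, u w = ‖F (tubePoint (x₀ + w.1) (y₀ + w.2))‖ₑ ^ q := by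
    intro w hw
    refine indicator_of_mem (s := U) (show y₀ + w.2 ∈ B from hy ?_) _
    simpa using (complexBall_subset hr hw).2
  rw [← setLIntegral_congr_fun hDm huD]
  have hrotD : ∀ θ w, rotation n θ w ∈ D ↔ w ∈ D := fun θ w => by
    simp only [hD, complexBall, mem_ofPred_eq, norm_sq_rotation]
  have hrotu : ∀ θ, ∫⁻ w in D, u (rotation n θ w) = ∫⁻ w in D, u w := by
    intro θ
    rw [← (measurePreserving_rotation θ).setLIntegral_comp_preimage hDm hu]
    congr 2
    ext w
    exact (hrotD θ w).symm
  -- The one-variable inequality on the complex disc through the centre in direction `w`.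
  -- Integrating over `w ∈ D` and swapping the integrals gives the claim, since rotations preserve
  -- `D` and its measure.
  have hcircle : ∀ w ∈ D, ‖F (tubePoint x₀ y₀)‖ₑ ^ q * ENNReal.ofReal (2 * Real.pi) ≤
      ∫⁻ θ in Ioc 0 (2 * Real.pi), u (rotation n θ w) := by
    intro w hw
    let f : ℂ → ℂ := fun ζ => F (tubePoint x₀ y₀ + ζ • tubePoint w.1 w.2)
    have hf : AnalyticOnNhd ℂ f (closedBall 0 1) := by
      have hdiff : DifferentiableOn ℂ f
          ((fun ζ : ℂ => tubePoint x₀ y₀ + ζ • tubePoint w.1 w.2) ⁻¹' tube B) :=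
        hF.comp (Differentiable.differentiableOn (by fun_prop)) fun _ h => h
      refine (hdiff.analyticOnNhd ((isOpen_tube hB).preimage (by fun_prop))).mono ?_
      intro ζ hζ
      rw [mem_preimage, tubePoint_add_smul, tubePoint_mem_tube]
      apply hy
      rw [mem_ball, dist_eq_norm, add_sub_cancel_left]
      have hζ1 : ζ.re ^ 2 + ζ.im ^ 2 ≤ 1 := by
        have h2 : ‖ζ‖ ≤ 1 := by simpa using hζ
        have h3 := Complex.sq_norm ζ
        rw [Complex.normSq_apply] at h3
        nlinarith [norm_nonneg ζ]
      have hwD : ‖w.1‖ ^ 2 + ‖w.2‖ ^ 2 < r ^ 2 := hw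
      have htri : ‖ζ.im • w.1 + ζ.re • w.2‖ ≤ |ζ.im| * ‖w.1‖ + |ζ.re| * ‖w.2‖ := by
        refine (norm_add_le _ _).trans ?_
        simp [norm_smul]
      refine htri.trans_lt (lt_of_pow_lt_pow_left₀ 2 hr.le ?_)
      have h4 : |ζ.im| ^ 2 + |ζ.re| ^ 2 ≤ 1 := by simp only [sq_abs]; linarith
      -- Cauchy–Schwarz in the plane, in the form of Lagrange's identity.
      nlinarith [sq_nonneg (|ζ.im| * ‖w.2‖ - |ζ.re| * ‖w.1‖), sq_nonneg ‖w.1‖, sq_nonneg ‖w.2‖]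
    have hmain := enorm_rpow_mul_le_lintegral hq hf
    have hrw : ∀ θ, ‖f (circleMap 0 1 θ)‖ₑ ^ q = u (rotation n θ w) := by
      intro θ
      rw [huD _ ((hrotD θ w).2 hw)]
      have hre : (circleMap 0 1 θ).re = Real.cos θ := by
        simp [circleMap_zero, Complex.exp_ofReal_mul_I_re]
      have him : (circleMap 0 1 θ).im = Real.sin θ := by
        simp [circleMap_zero, Complex.exp_ofReal_mul_I_im]
      simp only [f, tubePoint_add_smul, hre, him, rotation_apply]
    simp only [hrw] at hmain
    simpa [f] using hmain
  have hrotm : Measurable fun v : ((𝔼 n) × (𝔼 n)) × ℝ => u (rotation n v.2 v.1) := by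
    refine hu.comp (Continuous.measurable ?_)
    simp only [rotation_apply]
    fun_prop
  have hπ0 : ENNReal.ofReal (2 * Real.pi) ≠ 0 := by
    simpa using Real.pi_pos
  have hkey : ENNReal.ofReal (2 * Real.pi) * (‖F (tubePoint x₀ y₀)‖ₑ ^ q * volume D) ≤
      ENNReal.ofReal (2 * Real.pi) * ∫⁻ w in D, u w := by
    calc ENNReal.ofReal (2 * Real.pi) * (‖F (tubePoint x₀ y₀)‖ₑ ^ q * volume D)
        = ∫⁻ _ in D, ‖F (tubePoint x₀ y₀)‖ₑ ^ q * ENNReal.ofReal (2 * Real.pi) := by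
          rw [setLIntegral_const]; ring
      _ ≤ ∫⁻ w in D, ∫⁻ θ in Ioc 0 (2 * Real.pi), u (rotation n θ w) :=
          setLIntegral_mono' hDm hcircle
      _ = ∫⁻ θ in Ioc 0 (2 * Real.pi), ∫⁻ w in D, u (rotation n θ w) :=
          lintegral_lintegral_swap hrotm.aemeasurable
      _ = ENNReal.ofReal (2 * Real.pi) * ∫⁻ w in D, u w := by
          simp only [hrotu, setLIntegral_const, Real.volume_Ioc, sub_zero, mul_comm]
  exact (ENNReal.mul_le_mul_iff_right hπ0 ENNReal.ofReal_ne_top).1 hkey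

/-! ### From the norm to local boundedness and integrable slices -/

theorem rpow_le_one_add_rpow {a : ℝ≥0∞} {σ s : ℝ} (hσ : 0 ≤ σ) (h : σ ≤ s) :
    a ^ σ ≤ 1 + a ^ s := by
  rcases le_total a 1 with ha | ha
  · exact (ENNReal.rpow_le_one ha hσ).trans le_self_add
  · exact (ENNReal.rpow_le_rpow_of_exponent_le ha h).trans le_add_self

/-- Hölder's inequality. It passes from `|F|^(pσ)`, which the sub-mean value property produces, to
the power `σ` of the `p`-integral, which the norm controls. -/
theorem lintegral_rpow_mul_le {α : Type*} [MeasurableSpace α] {μ : Measure α} {h : α → ℂ}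
    (hh : AEStronglyMeasurable h μ) {p σ : ℝ} (hp : 0 < p) (hσ : 0 < σ) (hσ1 : σ ≤ 1) :
    ∫⁻ a, ‖h a‖ₑ ^ (p * σ) ∂μ ≤ (∫⁻ a, ‖h a‖ₑ ^ p ∂μ) ^ σ * μ univ ^ (1 - σ) := by
  have hpσ : 0 < p * σ := mul_pos hp hσ
  have key := ENNReal.rpow_le_rpow
    (eLpNorm'_le_eLpNorm'_mul_rpow_measure_univ hpσ (mul_le_of_le_one_right hp.le hσ1) hh) hpσ.le
  rw [ENNReal.mul_rpow_of_nonneg _ _ hpσ.le] at key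
  simp only [eLpNorm'_eq_lintegral_enorm, ← ENNReal.rpow_mul] at key
  convert key using 2
  · rw [one_div, inv_mul_cancel₀ hpσ.ne', ENNReal.rpow_one]
  · congr 1; field_simp
  · congr 1; field_simp

/-- Near a point of `B` the continuous `ψ` is bounded above, so the weight is bounded below and can
be divided out. This form treats finite and infinite `s` alike, with one `σ` for all points. -/
theorem exists_lintegral_rpow_lt_top {B : Set (𝔼 n)} (hB : IsOpen B) {ψ : (𝔼 n) → ℝ}
    (hψ : ContinuousOn ψ B) {p : ℝ} (hp : 0 < p) {s : ℝ≥0∞} (hs : 0 < s)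
    {F : EuclideanSpace ℂ (Fin n) → ℂ} (hF : bergmanNorm B ψ p s F < ∞) :
    ∃ σ : ℝ, 0 < σ ∧ σ ≤ 1 ∧ ∀ y₀ ∈ B, ∃ r > 0, ball y₀ r ⊆ B ∧
      ∫⁻ y in ball y₀ r, (∫⁻ x, ‖F (tubePoint x y)‖ₑ ^ p) ^ σ < ∞ := by
  have hloc : ∀ y₀ ∈ B, ∃ r > 0, ball y₀ r ⊆ B ∧ ∀ y ∈ ball y₀ r, ψ y ≤ ψ y₀ + 1 := by
    intro y₀ hy₀
    have h1 : ∀ᶠ y in nhds y₀, y ∈ B ∧ ψ y < ψ y₀ + 1 :=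
      Filter.Eventually.and (hB.mem_nhds hy₀)
        ((hψ.continuousAt (hB.mem_nhds hy₀)).eventually_lt_const (by linarith))
    obtain ⟨r, hr, h⟩ := Metric.eventually_nhds_iff_ball.1 h1
    exact ⟨r, hr, fun y hy => (h y hy).1, fun y hy => (h y hy).2.le⟩
  have hexp : ∀ {a b : ℝ}, a ≤ b → ENNReal.ofReal (Real.exp (-2 * Real.pi * b)) ≤
      ENNReal.ofReal (Real.exp (-2 * Real.pi * a)) := by
    intro a b hab
    apply ENNReal.ofReal_le_ofReal
    apply Real.exp_le_exp.2
    nlinarith [Real.pi_pos]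
  unfold bergmanNorm at hF
  split_ifs at hF with hs'
  · refine ⟨1, one_pos, le_rfl, fun y₀ hy₀ => ?_⟩
    obtain ⟨r, hr, hrB, hrψ⟩ := hloc y₀ hy₀
    refine ⟨r, hr, hrB, ?_⟩
    set N := ⨆ y ∈ B, ENNReal.ofReal (Real.exp (-2 * Real.pi * ψ y)) *
      (∫⁻ x : EuclideanSpace ℝ (Fin n), ‖F (tubePoint x y)‖ₑ ^ p) ^ (1 / p)
    set c := ENNReal.ofReal (Real.exp (-2 * Real.pi * (ψ y₀ + 1))) with hc
    have hc0 : c ≠ 0 := by simp [hc, Real.exp_pos]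
    have hct : c ≠ ∞ := ENNReal.ofReal_ne_top
    have hbd : ∀ y ∈ ball y₀ r, (∫⁻ x, ‖F (tubePoint x y)‖ₑ ^ p) ^ (1 : ℝ) ≤ (N / c) ^ p := by
      intro y hy
      have h1 : c * (∫⁻ x, ‖F (tubePoint x y)‖ₑ ^ p) ^ (1 / p) ≤ N := by
        refine le_trans ?_ (le_iSup₂ (f := fun y (_ : y ∈ B) =>
          ENNReal.ofReal (Real.exp (-2 * Real.pi * ψ y)) *
          (∫⁻ x : EuclideanSpace ℝ (Fin n), ‖F (tubePoint x y)‖ₑ ^ p) ^ (1 / p)) y (hrB hy))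
        gcongr
        exact hexp (hrψ y hy)
      have h2 := ENNReal.rpow_le_rpow ((ENNReal.le_div_iff_mul_le (Or.inl hc0) (Or.inl hct)).2
        ((mul_comm _ _).trans_le h1)) hp.le
      rwa [← ENNReal.rpow_mul, one_div, inv_mul_cancel₀ hp.ne'] at h2
    calc _ ≤ ∫⁻ _ in ball y₀ r, (N / c) ^ p := setLIntegral_mono' measurableSet_ball hbd
      _ < ∞ := by
        rw [setLIntegral_const]
        exact ENNReal.mul_lt_top
          (ENNReal.rpow_lt_top_of_nonneg hp.le (ENNReal.div_lt_top hF.ne hc0).ne)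
          measure_ball_lt_top
  · set s' := s.toReal
    have hs0 : 0 < s' := ENNReal.toReal_pos hs.ne' hs'
    -- Capping the exponent at `1`, as Hölder in `x` needs, costs only the finite volume of the
    -- ball.
    refine ⟨min 1 s', lt_min one_pos hs0, min_le_left _ _, fun y₀ hy₀ => ?_⟩
    obtain ⟨r, hr, hrB, hrψ⟩ := hloc y₀ hy₀
    refine ⟨r, hr, hrB, ?_⟩
    set c := ENNReal.ofReal (Real.exp (-2 * Real.pi * (ψ y₀ + 1))) with hc
    have hc0 : c ≠ 0 := by simp [hc, Real.exp_pos]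
    have hct : c ≠ ∞ := ENNReal.ofReal_ne_top
    rw [ENNReal.rpow_lt_top_iff_of_pos (by positivity)] at hF
    have hcs : (c ^ p) ^ s' ≠ ∞ := ENNReal.rpow_ne_top_of_nonneg hs0.le
      (ENNReal.rpow_ne_top_of_nonneg hp.le hct)
    have hcs0 : (c ^ p) ^ s' ≠ 0 := by
      simp [ENNReal.rpow_eq_zero_iff, hc0, hct, hp.not_gt, hs0.not_gt]
    have h1 : (c ^ p) ^ s' * ∫⁻ y in ball y₀ r, (∫⁻ x, ‖F (tubePoint x y)‖ₑ ^ p) ^ s' < ∞ := by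
      rw [← lintegral_const_mul' _ _ hcs]
      refine lt_of_le_of_lt ?_ ((lintegral_mono_set hrB).trans_lt hF)
      refine setLIntegral_mono' measurableSet_ball fun y hy => ?_
      rw [← ENNReal.mul_rpow_of_nonneg _ _ hs0.le]
      refine ENNReal.rpow_le_rpow ?_ hs0.le
      rw [← lintegral_const_mul' _ _ (ENNReal.rpow_ne_top_of_nonneg hp.le hct)]
      refine lintegral_mono fun x => ?_
      rw [← ENNReal.mul_rpow_of_nonneg _ _ hp.le]
      refine ENNReal.rpow_le_rpow ?_ hp.le
      rw [enorm_mul, mul_comm]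
      gcongr
      refine (hexp (hrψ y hy)).trans (le_of_eq ?_)
      rw [← ofReal_norm, Complex.norm_real, Real.norm_of_nonneg (Real.exp_pos _).le]
    have h2 : ∫⁻ y in ball y₀ r, (∫⁻ x, ‖F (tubePoint x y)‖ₑ ^ p) ^ s' < ∞ :=
      ENNReal.lt_top_of_mul_ne_top_right h1.ne hcs0
    calc _ ≤ ∫⁻ y in ball y₀ r, (1 + (∫⁻ x, ‖F (tubePoint x y)‖ₑ ^ p) ^ s') :=
          lintegral_mono fun y => rpow_le_one_add_rpow (lt_min one_pos hs0).le (min_le_right _ _)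
      _ = volume (ball y₀ r) + ∫⁻ y in ball y₀ r, (∫⁻ x, ‖F (tubePoint x y)‖ₑ ^ p) ^ s' := by
          rw [lintegral_add_left measurable_const, setLIntegral_one]
      _ < ∞ := ENNReal.add_lt_top.2 ⟨measure_ball_lt_top, h2⟩

/-- Otherwise `g` would be infinite on a ball of positive measure. This yields the density of the
good heights, without measurability of `g`. -/
theorem exists_mem_ball_lt_top {g : (𝔼 n) → ℝ≥0∞} {σ : ℝ} (hσ : 0 < σ) {y₀ : 𝔼 n} {r : ℝ}
    (hg : ∫⁻ y in ball y₀ r, g y ^ σ < ∞) {δ : ℝ} (hδ : 0 < δ) (hr : 0 < r) :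
    ∃ y ∈ ball y₀ r, dist y y₀ < δ ∧ g y < ∞ := by
  by_contra! h
  have h1 : ∫⁻ _ in ball y₀ (min r δ), (∞ : ℝ≥0∞) ≤ ∫⁻ y in ball y₀ r, g y ^ σ := by
    refine (setLIntegral_mono' measurableSet_ball fun y hy => ?_).trans
      (lintegral_mono_set (ball_subset_ball (min_le_left r δ)))
    have hy' := mem_ball.1 hy
    have := h y (mem_ball.2 (hy'.trans_le (min_le_left _ _))) (hy'.trans_le (min_le_right _ _))
    rw [top_le_iff.1 this, ENNReal.top_rpow_of_pos hσ]
  rw [setLIntegral_const, ENNReal.top_mul (measure_ball_pos _ _ (lt_min hr hδ)).ne'] at h1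
  exact (h1.trans_lt hg).ne rfl

/-- The sub-mean value property on balls of radius `r / 2`, which stay over `ball y₀ r`, then
Tonelli and Hölder in `x`. The bound is uniform in `x` because the inner integrals end up over all
of `ℝⁿ` and are translation invariant. -/
theorem exists_norm_le_of_lintegral_rpow_lt_top {B : Set (𝔼 n)} (hB : IsOpen B)
    {F : EuclideanSpace ℂ (Fin n) → ℂ} (hF : DifferentiableOn ℂ F (tube B)) {p σ : ℝ} (hp : 0 < p)
    (hσ : 0 < σ) (hσ1 : σ ≤ 1) {y₀ : 𝔼 n} {r : ℝ} (hr : 0 < r) (hrB : ball y₀ r ⊆ B)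
    (hI : ∫⁻ y in ball y₀ r, (∫⁻ x, ‖F (tubePoint x y)‖ₑ ^ p) ^ σ < ∞) :
    ∃ M : ℝ, ∀ x, ∀ y ∈ ball y₀ (r / 2), ‖F (tubePoint x y)‖ ≤ M := by
  set I := ∫⁻ y in ball y₀ r, (∫⁻ x, ‖F (tubePoint x y)‖ₑ ^ p) ^ σ
  have hr2 : 0 < r / 2 := by positivity
  have hq : 0 < p * σ := mul_pos hp hσ
  set S := ball (0 : 𝔼 n) (r / 2) with hS
  set K := volume S ^ (1 - σ) with hK
  have hKt : K ≠ ∞ := ENNReal.rpow_ne_top_of_nonneg (by linarith) measure_ball_lt_top.ne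
  set V := volume (complexBall n (r / 2)) with hV
  have hV0 : V ≠ 0 := (volume_complexBall_pos hr2).ne'
  have hVt : V ≠ ∞ := (volume_complexBall_lt_top hr2).ne
  have key : ∀ x, ∀ y ∈ ball y₀ (r / 2), ‖F (tubePoint x y)‖ₑ ^ (p * σ) * V ≤ I * K := by
    intro x₁ y₁ hy₁
    have hsub : ball y₁ (r / 2) ⊆ ball y₀ r := by
      apply ball_subset_ball'
      have := mem_ball.1 hy₁
      linarith
    have hcont : ContinuousOn (fun w : (𝔼 n) × (𝔼 n) => F (tubePoint (x₁ + w.1) (y₁ + w.2)))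
        (S ×ˢ S) := by
      refine hF.continuousOn.comp (Continuous.continuousOn ?_) fun w hw =>
        tubePoint_mem_tube.2 (hrB (hsub ?_))
      · exact continuous_tubePoint.comp
          (by fun_prop : Continuous fun w : (𝔼 n) × (𝔼 n) => (x₁ + w.1, y₁ + w.2))
      · simpa [hS] using hw.2
    calc ‖F (tubePoint x₁ y₁)‖ₑ ^ (p * σ) * V
        ≤ ∫⁻ w in complexBall n (r / 2), ‖F (tubePoint (x₁ + w.1) (y₁ + w.2))‖ₑ ^ (p * σ) :=
          enorm_rpow_mul_volume_le hB hF hq hr2 x₁ (hsub.trans hrB)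
      _ ≤ ∫⁻ w in S ×ˢ S, ‖F (tubePoint (x₁ + w.1) (y₁ + w.2))‖ₑ ^ (p * σ) :=
          lintegral_mono_set (complexBall_subset hr2)
      _ = ∫⁻ y in S, ∫⁻ x in S, ‖F (tubePoint (x₁ + x) (y₁ + y))‖ₑ ^ (p * σ) := by
          rw [Measure.volume_eq_prod, ← Measure.prod_restrict, lintegral_prod_symm]
          rw [Measure.prod_restrict]
          exact ((ENNReal.continuous_rpow_const.comp_continuousOn hcont.enorm).aemeasurable
            (measurableSet_ball.prod measurableSet_ball))
      _ ≤ ∫⁻ y in S, (∫⁻ x, ‖F (tubePoint x (y₁ + y))‖ₑ ^ p) ^ σ * K := by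
          refine setLIntegral_mono' measurableSet_ball fun y hy => ?_
          have hm : AEStronglyMeasurable (fun x => F (tubePoint (x₁ + x) (y₁ + y)))
              (volume.restrict S) :=
            (hcont.comp (by fun_prop : ContinuousOn (fun x => (x, y)) S)
              fun x hx => ⟨hx, hy⟩).aestronglyMeasurable measurableSet_ball
          refine (lintegral_rpow_mul_le hm hp hσ hσ1).trans ?_
          rw [Measure.restrict_apply_univ]
          refine mul_le_mul_left (ENNReal.rpow_le_rpow ?_ hσ.le) _
          refine (setLIntegral_le_lintegral _ _).trans (le_of_eq ?_)
          exact lintegral_add_left_eq_self (fun x => ‖F (tubePoint x (y₁ + y))‖ₑ ^ p) x₁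
      _ = (∫⁻ y in S, (∫⁻ x, ‖F (tubePoint x (y₁ + y))‖ₑ ^ p) ^ σ) * K :=
          lintegral_mul_const' _ _ hKt
      _ ≤ I * K := by
          gcongr
          refine le_trans (le_of_eq ?_) (lintegral_mono_set hsub)
          rw [← lintegral_indicator measurableSet_ball, ← lintegral_indicator measurableSet_ball,
            ← lintegral_add_left_eq_self ((ball y₁ (r / 2)).indicator _) y₁]
          congr 1
          ext y
          simp [indicator]
  refine ⟨((I * K / V) ^ (1 / (p * σ))).toReal, fun x y hy => ?_⟩
  have h1 := (ENNReal.le_div_iff_mul_le (Or.inl hV0) (Or.inl hVt)).2 (key x y hy)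
  have h2 := ENNReal.rpow_le_rpow h1 (by positivity : 0 ≤ 1 / (p * σ))
  rw [← ENNReal.rpow_mul, mul_one_div_cancel hq.ne', ENNReal.rpow_one] at h2
  rw [← toReal_enorm]
  refine ENNReal.toReal_mono (ENNReal.rpow_ne_top_of_nonneg (by positivity) ?_) h2
  exact (ENNReal.div_lt_top (ENNReal.mul_ne_top hI.ne hKt) hV0).ne

theorem continuous_tubePoint_left {B : Set (𝔼 n)} {F : EuclideanSpace ℂ (Fin n) → ℂ}
    (hF : ContinuousOn F (tube B)) {y : 𝔼 n} (hy : y ∈ B) :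
    Continuous fun x => F (tubePoint x y) := by
  rw [← continuousOn_univ]
  exact hF.comp (continuous_tubePoint.comp (by fun_prop : Continuous fun x => (x, y))).continuousOn
    fun x _ => tubePoint_mem_tube.2 hy

/-- `|f| = |f|^(1-p) |f|^p ≤ M^(1-p) |f|^p`; this is where `p ≤ 1` enters. -/
theorem integrable_of_norm_le {f : (𝔼 n) → ℂ} (hf : AEStronglyMeasurable f) {p : ℝ} (hp : 0 < p)
    (hp1 : p ≤ 1) {M : ℝ} (hM : ∀ x, ‖f x‖ ≤ M) (h : ∫⁻ x, ‖f x‖ₑ ^ p < ∞) : Integrable f := by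
  refine ⟨hf, ?_⟩
  have hbd : ∀ x, ‖f x‖ₑ ≤ ENNReal.ofReal M ^ (1 - p) * ‖f x‖ₑ ^ p := by
    intro x
    calc ‖f x‖ₑ = ‖f x‖ₑ ^ (1 - p) * ‖f x‖ₑ ^ p := by
          rw [← ENNReal.rpow_add_of_nonneg _ _ (by linarith) hp.le]; simp
      _ ≤ _ := by
          have hx : ‖f x‖ₑ ≤ ENNReal.ofReal M := by
            rw [← ofReal_norm]
            exact ENNReal.ofReal_le_ofReal (hM x)
          exact mul_le_mul_left (ENNReal.rpow_le_rpow hx (by linarith)) _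
  have ht : ENNReal.ofReal M ^ (1 - p) ≠ ∞ :=
    ENNReal.rpow_ne_top_of_nonneg (by linarith) ENNReal.ofReal_ne_top
  refine (lintegral_mono hbd).trans_lt ?_
  rw [lintegral_const_mul' _ _ ht]
  exact ENNReal.mul_lt_top ht.lt_top h

/-! ### Contour shift under Gaussian decay -/

theorem integrable_exp_neg_mul_norm_sq {ε : ℝ} (hε : 0 < ε) :
    Integrable fun x : 𝔼 n => Real.exp (-ε * ‖x‖ ^ 2) := by
  have h := (GaussianFourier.integrable_cexp_neg_mul_sq_norm_add (V := 𝔼 n) (b := (ε : ℂ))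
    (by simpa using hε) 0 0).norm
  refine h.congr (ae_of_all _ fun x => ?_)
  simp [Complex.norm_exp, ← Complex.ofReal_pow, ← Complex.ofReal_mul]

theorem exp_neg_mul_norm_add_sq_le {ε A : ℝ} (hε : 0 < ε) (x a : 𝔼 n) (ha : ‖a‖ ≤ A) :
    Real.exp (-ε * ‖x + a‖ ^ 2) ≤ Real.exp (ε * A ^ 2) * Real.exp (-(ε / 2) * ‖x‖ ^ 2) := by
  rw [← Real.exp_add]
  apply Real.exp_le_exp.2
  have h1 : ‖x‖ ≤ ‖x + a‖ + ‖a‖ := by simpa using norm_sub_le (x + a) a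
  have h2 : ‖x‖ ^ 2 ≤ 2 * ‖x + a‖ ^ 2 + 2 * A ^ 2 := by
    nlinarith [norm_nonneg x, norm_nonneg a, norm_nonneg (x + a), sq_nonneg (‖x + a‖ - ‖a‖)]
  nlinarith

/-- The integral of a holomorphic function over a horizontal slice of a tube does not depend on the
slice, if the function has Gaussian decay. -/
theorem integral_tubePoint_eq_of_norm_le {y₀ : 𝔼 n} {r : ℝ} {H : EuclideanSpace ℂ (Fin n) → ℂ}
    (hH : DifferentiableOn ℂ H (tube (ball y₀ r))) {ε C : ℝ} (hε : 0 < ε)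
    (hC : ∀ x, ∀ y ∈ ball y₀ r, ‖H (tubePoint x y)‖ ≤ C * Real.exp (-ε * ‖x‖ ^ 2))
    {y : 𝔼 n} (hy : y ∈ ball y₀ r) :
    ∫ x, H (tubePoint x y) = ∫ x, H (tubePoint x y₀) := by
  set v := y - y₀ with hv
  have hvr : ‖v‖ < r := by rwa [hv, ← dist_eq_norm]
  have hr : 0 < r := (norm_nonneg v).trans_lt hvr
  have hC0 : 0 ≤ C := by
    have h := (norm_nonneg _).trans (hC 0 y₀ (mem_ball_self hr))
    simpa using h
  -- The open strip `|Im w| < a` must contain both `0` and `I`, hence `a > 1`, while `y₀ + (Im w) v`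
  -- stays in the ball, hence `a ‖v‖ ≤ r`.
  set a := 1 + (r - ‖v‖) / r with ha
  have ha1 : 1 < a := by
    have : 0 < (r - ‖v‖) / r := div_pos (by linarith) hr
    linarith
  have hav : a * ‖v‖ ≤ r := by
    have h2 : (r - ‖v‖) / r * ‖v‖ ≤ r - ‖v‖ := by
      rw [div_mul_eq_mul_div, div_le_iff₀ hr]
      nlinarith [norm_nonneg v]
    rw [ha, add_mul, one_mul]
    linarith
  set S : Set ℂ := Complex.im ⁻¹' Ioo (-a) a with hS
  have hSo : IsOpen S := isOpen_Ioo.preimage Complex.continuous_im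
  have hSc : IsPreconnected S :=
    ((convex_Ioo (-a) a).linear_preimage Complex.imLm).isPreconnected
  let h : (𝔼 n) → ℂ → ℂ := fun x w => H (tubePoint x y₀ + w • tubePoint v 0)
  have hform : ∀ x w, h x w = H (tubePoint (x + w.re • v) (y₀ + w.im • v)) := by
    intro x w
    simp [h, tubePoint_add_smul]
  have hSmem : ∀ w ∈ S, y₀ + w.im • v ∈ ball y₀ r := by
    intro w hw
    have hw' : |w.im| < a := abs_lt.2 hw
    rw [mem_ball, dist_eq_norm, add_sub_cancel_left, norm_smul, Real.norm_eq_abs]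
    rcases (norm_nonneg v).eq_or_lt with h0 | h0
    · rw [← h0, mul_zero]; exact hr
    · exact (mul_lt_mul_of_pos_right hw' h0).trans_le hav
  have hdiff : ∀ x, DifferentiableOn ℂ (h x) S := by
    intro x
    refine hH.comp (Differentiable.differentiableOn (by fun_prop)) fun w hw => ?_
    rw [tubePoint_add_smul, tubePoint_mem_tube]
    simpa using hSmem w hw
  have hcont : ∀ w ∈ S, Continuous fun x => h x w := by
    intro w hw
    simp only [hform]
    exact (continuous_tubePoint_left hH.continuousOn (hSmem w hw)).comp (by fun_prop)
  have hbound : ∀ w ∈ S, ∀ A, |w.re| * ‖v‖ ≤ A → ∀ x,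
      ‖h x w‖ ≤ C * Real.exp (ε * A ^ 2) * Real.exp (-(ε / 2) * ‖x‖ ^ 2) := by
    intro w hw A hA x
    rw [hform, mul_assoc]
    refine (hC _ _ (hSmem w hw)).trans ?_
    gcongr
    exact exp_neg_mul_norm_add_sq_le hε x _ (by rwa [norm_smul, Real.norm_eq_abs])
  have hint : ∀ A : ℝ, Integrable fun x : 𝔼 n =>
      C * Real.exp (ε * A ^ 2) * Real.exp (-(ε / 2) * ‖x‖ ^ 2) := fun A =>
    (integrable_exp_neg_mul_norm_sq (half_pos hε)).const_mul _
  let Φ : ℂ → ℂ := fun w => ∫ x, h x w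
  -- A real shift of `w` is a translation of `x`. So the holomorphic `Φ` has zero derivative along
  -- the real direction and is constant on the strip; compare `w = I` with `w = 0`.
  have htrans : ∀ w, ∀ τ : ℝ, Φ (w + τ) = Φ w := by
    intro w τ
    simp only [Φ, hform]
    rw [← integral_add_right_eq_self (fun x => H (tubePoint (x + w.re • v) (y₀ + w.im • v)))
      (τ • v)]
    congr 1
    ext x
    congr 2
    · simp only [Complex.add_re, Complex.ofReal_re]
      module
    · simp
  have hderiv : ∀ w ∈ S, HasDerivAt Φ (∫ x, deriv (h x) w) w := by
    intro w hw
    obtain ⟨ρ, hρ, hρS⟩ := nhds_basis_closedBall.mem_iff.1 (hSo.mem_nhds hw)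
    have hρ2 : 0 < ρ / 2 := half_pos hρ
    set A := (|w.re| + ρ) * ‖v‖ with hA
    have hbd : ∀ ζ ∈ closedBall w ρ, ∀ x,
        ‖h x ζ‖ ≤ C * Real.exp (ε * A ^ 2) * Real.exp (-(ε / 2) * ‖x‖ ^ 2) := by
      intro ζ hζ
      refine hbound ζ (hρS hζ) A ?_
      refine mul_le_mul_of_nonneg_right ?_ (norm_nonneg _)
      have h1 : |ζ.re - w.re| ≤ ρ := by
        refine le_trans ?_ (mem_closedBall.1 hζ)
        rw [dist_eq_norm, ← Complex.sub_re]
        exact Complex.abs_re_le_norm _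
      have h2 := abs_sub_abs_le_abs_sub ζ.re w.re
      linarith
    -- A pointwise limit of difference quotients; real increments keep the points in the strip.
    have hmeas : AEStronglyMeasurable (fun x => deriv (h x) w) := by
      have hu : Tendsto (fun k : ℕ => w + ((1 / ((k : ℝ) + 1) : ℝ) : ℂ)) atTop (𝓝[≠] w) := by
        refine tendsto_nhdsWithin_iff.2 ⟨?_, Eventually.of_forall fun k => ?_⟩
        · have h1 : Tendsto (fun k : ℕ => ((1 / ((k : ℝ) + 1) : ℝ) : ℂ)) atTop (𝓝 ((0 : ℝ) : ℂ)) :=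
            (Complex.continuous_ofReal.tendsto 0).comp tendsto_one_div_add_atTop_nhds_zero_nat
          simpa using h1.const_add w
        · have : ((1 / ((k : ℝ) + 1) : ℝ) : ℂ) ≠ 0 :=
            Complex.ofReal_ne_zero.2 (by positivity)
          simpa using this
      refine aestronglyMeasurable_of_tendsto_ae atTop
        (f := fun (k : ℕ) x => slope (h x) w (w + ((1 / ((k : ℝ) + 1) : ℝ) : ℂ))) ?_ ?_
      · intro k
        simp only [slope_def_module]
        have h1 := hcont (w + ((1 / ((k : ℝ) + 1) : ℝ) : ℂ)) (by simpa [hS] using hw)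
        have h2 := hcont w hw
        exact Continuous.aestronglyMeasurable (by fun_prop)
      · refine ae_of_all _ fun x => ?_
        exact (((hdiff x).differentiableAt (hSo.mem_nhds hw)).hasDerivAt.tendsto_slope).comp hu
    refine (hasDerivAt_integral_of_dominated_loc_of_deriv_le (ball_mem_nhds w hρ2)
      (F := fun w x => h x w) (F' := fun w x => deriv (h x) w)
      (bound := fun x => C * Real.exp (ε * A ^ 2) * Real.exp (-(ε / 2) * ‖x‖ ^ 2) / (ρ / 2))
      ?_ ?_ hmeas ?_ ((hint A).div_const _) ?_).2
    · filter_upwards [hSo.mem_nhds hw] with ζ hζ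
      exact (hcont ζ hζ).aestronglyMeasurable
    · exact (hint A).mono' (hcont w hw).aestronglyMeasurable
        (ae_of_all _ (hbd w (mem_closedBall_self hρ.le)))
    · refine ae_of_all _ fun x ζ hζ => ?_
      have hsub : closedBall ζ (ρ / 2) ⊆ closedBall w ρ := by
        apply closedBall_subset_closedBall'
        have := mem_ball.1 hζ
        linarith
      -- Cauchy's estimate on a circle of radius `ρ / 2` supplies the dominating function.
      refine Complex.norm_deriv_le_of_forall_mem_sphere_norm_le hρ2 ?_ fun ξ hξ =>
        hbd ξ (hsub (sphere_subset_closedBall hξ)) x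
      exact ((hdiff x).mono (hsub.trans hρS)).diffContOnCl_ball subset_rfl
    · refine ae_of_all _ fun x ζ hζ => ?_
      have hζS : ζ ∈ S := hρS (ball_subset_closedBall (ball_subset_ball (by linarith) hζ))
      exact ((hdiff x).differentiableAt (hSo.mem_nhds hζS)).hasDerivAt
  have hzero : ∀ w ∈ S, deriv Φ w = 0 := by
    intro w hw
    rw [(hderiv w hw).deriv]
    have h1 : HasDerivAt (fun ζ => Φ (w + ζ)) (∫ x, deriv (h x) w) ((0 : ℝ) : ℂ) := by
      apply HasDerivAt.comp_const_add
      simpa using hderiv w hw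
    have h2 := h1.comp_ofReal
    simp only [htrans] at h2
    exact h2.unique (hasDerivAt_const _ _)
  have hfin := hSo.is_const_of_deriv_eq_zero hSc
    (fun w hw => (hderiv w hw).differentiableAt.differentiableWithinAt) hzero
    (show Complex.I ∈ S by simp [hS]; constructor <;> linarith)
    (show (0 : ℂ) ∈ S by simp [hS]; linarith)
  simpa [Φ, hform, hv] using hfin

/-! ### Independence of the Fourier transform from the slice -/

theorem bilin_tubePoint (t x y : 𝔼 n) :
    bilin t (tubePoint x y) = (inner ℝ x t : ℝ) + (inner ℝ y t : ℝ) * Complex.I := by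
  simp only [bilin, tubePoint, PiLp.inner_apply, RCLike.inner_apply, conj_trivial,
    Complex.ofReal_sum, Finset.sum_mul, ← Finset.sum_add_distrib]
  refine Finset.sum_congr rfl fun k _ => ?_
  push_cast
  ring

theorem re_sum_sq_tubePoint (x y : 𝔼 n) :
    (∑ k, (tubePoint x y k) ^ 2).re = ‖x‖ ^ 2 - ‖y‖ ^ 2 := by
  rw [EuclideanSpace.real_norm_sq_eq, EuclideanSpace.real_norm_sq_eq, ← Finset.sum_sub_distrib,
    Complex.re_sum]
  refine Finset.sum_congr rfl fun k _ => ?_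
  simp [tubePoint, pow_two]

/-- The exponential `exp (- 2 π i t · z)` damped by the Gaussian `exp (- ε z · z)`. -/
noncomputable def dampedExp (ε : ℝ) (t : 𝔼 n) (z : EuclideanSpace ℂ (Fin n)) : ℂ :=
  Complex.exp (-ε * ∑ k, (z k) ^ 2 - 2 * Real.pi * Complex.I * bilin t z)

theorem differentiable_dampedExp (ε : ℝ) (t : 𝔼 n) : Differentiable ℂ (dampedExp ε t) := by
  unfold dampedExp bilin
  fun_prop

theorem norm_dampedExp (ε : ℝ) (t x y : 𝔼 n) :
    ‖dampedExp ε t (tubePoint x y)‖ =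
      Real.exp (ε * ‖y‖ ^ 2 + 2 * Real.pi * inner ℝ y t) * Real.exp (-ε * ‖x‖ ^ 2) := by
  rw [dampedExp, Complex.norm_exp, ← Real.exp_add, bilin_tubePoint]
  congr 1
  have h := re_sum_sq_tubePoint x y
  rw [Complex.sub_re, ← Complex.ofReal_neg, Complex.re_ofReal_mul, h]
  simp
  ring

/-- `F` is bounded on the tubes over small balls around every point of `B`. -/
def LocallyBoundedOnTube (B : Set (𝔼 n)) (F : EuclideanSpace ℂ (Fin n) → ℂ) : Prop :=
  ∀ y₀ ∈ B, ∃ r > 0, ball y₀ r ⊆ B ∧ ∃ M : ℝ, ∀ x, ∀ y ∈ ball y₀ r, ‖F (tubePoint x y)‖ ≤ M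

/-- Locally this is the contour shift: boundedness of `F` and the Gaussian factor give the required
decay. Connectedness of `B` makes it global. -/
theorem integral_mul_dampedExp_eq {B : Set (𝔼 n)} (hBc : IsPreconnected B)
    {F : EuclideanSpace ℂ (Fin n) → ℂ} (hF : DifferentiableOn ℂ F (tube B))
    (hb : LocallyBoundedOnTube B F) {ε : ℝ} (hε : 0 < ε) (t : 𝔼 n) {y y' : 𝔼 n} (hy : y ∈ B)
    (hy' : y' ∈ B) :
    ∫ x, F (tubePoint x y) * dampedExp ε t (tubePoint x y) =
      ∫ x, F (tubePoint x y') * dampedExp ε t (tubePoint x y') := by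
  refine hBc.induction₂ (fun y y' => ∫ x, F (tubePoint x y) * dampedExp ε t (tubePoint x y) =
      ∫ x, F (tubePoint x y') * dampedExp ε t (tubePoint x y')) ?_
    (fun _ _ _ _ _ _ h h' => h.trans h') (fun _ _ _ _ h => h.symm) hy hy'
  intro y₀ hy₀
  obtain ⟨r, hr, hrB, M, hM⟩ := hb y₀ hy₀
  filter_upwards [mem_nhdsWithin_of_mem_nhds (ball_mem_nhds y₀ hr)] with y hy
  symm
  have hM0 : 0 ≤ M := (norm_nonneg _).trans (hM 0 y₀ (mem_ball_self hr))
  have hsub : tube (ball y₀ r) ⊆ tube B := fun z hz => hrB hz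
  refine integral_tubePoint_eq_of_norm_le (H := fun z => F z * dampedExp ε t z)
    ((hF.mono hsub).mul (differentiable_dampedExp ε t).differentiableOn) hε
    (C := M * Real.exp (ε * (‖y₀‖ + r) ^ 2 + 2 * Real.pi * ((‖y₀‖ + r) * ‖t‖))) ?_ hy
  intro x y hy
  have hyn : ‖y‖ ≤ ‖y₀‖ + r := by
    have h1 := mem_ball_iff_norm.1 hy
    have h2 := norm_le_norm_add_norm_sub' y y₀
    linarith
  rw [norm_mul, norm_dampedExp, ← mul_assoc]
  have hin : inner ℝ y t ≤ (‖y₀‖ + r) * ‖t‖ :=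
    (real_inner_le_norm y t).trans (by gcongr)
  have h2 : (0 : ℝ) ≤ 2 * Real.pi := Real.two_pi_pos.le
  gcongr
  exact hM x y hy

/-- Dominated convergence removes the damping along `ε = 1 / (k + 1)`; since `ε ≤ 1`, a multiple of
`|F|` dominates. -/
theorem tendsto_integral_mul_dampedExp {F : EuclideanSpace ℂ (Fin n) → ℂ} {y : 𝔼 n}
    (hF : Integrable fun x => F (tubePoint x y)) (t : 𝔼 n) :
    Tendsto (fun k : ℕ => ∫ x, F (tubePoint x y) *
        dampedExp (1 / ((k : ℝ) + 1)) t (tubePoint x y)) atTop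
      (𝓝 (Real.exp (2 * Real.pi * inner ℝ y t) * 𝓕 (fun x => F (tubePoint x y)) t)) := by
  have hlim : (Real.exp (2 * Real.pi * inner ℝ y t) : ℂ) * 𝓕 (fun x => F (tubePoint x y)) t =
      ∫ x, F (tubePoint x y) * dampedExp 0 t (tubePoint x y) := by
    rw [Real.fourier_eq', ← integral_const_mul]
    congr 1
    ext x
    rw [dampedExp, bilin_tubePoint, smul_eq_mul, ← mul_assoc, Complex.ofReal_exp,
      ← Complex.exp_add, mul_comm]
    congr 2
    push_cast
    linear_combination (2 * (Real.pi : ℂ) * (inner ℝ y t : ℝ)) * Complex.I_sq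
  rw [hlim]
  have hcont : ∀ ε, Continuous fun x => dampedExp ε t (tubePoint x y) := fun ε =>
    (differentiable_dampedExp ε t).continuous.comp
      (continuous_tubePoint.comp (by fun_prop : Continuous fun x => (x, y)))
  refine tendsto_integral_of_dominated_convergence
    (fun x => ‖F (tubePoint x y)‖ * Real.exp (‖y‖ ^ 2 + 2 * Real.pi * inner ℝ y t)) ?_
    (hF.norm.mul_const _) ?_ ?_
  · exact fun k => hF.aestronglyMeasurable.mul (hcont _).aestronglyMeasurable
  · refine fun k => ae_of_all _ fun x => ?_
    have hk1 : 1 / ((k : ℝ) + 1) ≤ 1 := by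
      rw [div_le_one (by positivity)]
      linarith [(Nat.cast_nonneg k : (0 : ℝ) ≤ k)]
    have hk0 : 0 ≤ 1 / ((k : ℝ) + 1) := by positivity
    rw [norm_mul, norm_dampedExp, ← Real.exp_add]
    refine mul_le_mul_of_nonneg_left (Real.exp_le_exp.2 ?_) (norm_nonneg _)
    nlinarith [mul_le_mul_of_nonneg_right hk1 (sq_nonneg ‖y‖), mul_nonneg hk0 (sq_nonneg ‖x‖)]
  · refine ae_of_all _ fun x => Tendsto.const_mul _ ?_
    have hc : Continuous fun ε : ℝ => dampedExp ε t (tubePoint x y) := by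
      unfold dampedExp
      fun_prop
    exact (hc.tendsto 0).comp tendsto_one_div_add_atTop_nhds_zero_nat

theorem exp_mul_fourier_eq {B : Set (𝔼 n)} (hBc : IsPreconnected B)
    {F : EuclideanSpace ℂ (Fin n) → ℂ} (hF : DifferentiableOn ℂ F (tube B))
    (hb : LocallyBoundedOnTube B F) {y y' : 𝔼 n} (hy : y ∈ B) (hy' : y' ∈ B)
    (hi : Integrable fun x => F (tubePoint x y)) (hi' : Integrable fun x => F (tubePoint x y'))
    (t : 𝔼 n) :
    (Real.exp (2 * Real.pi * inner ℝ y t) : ℂ) * 𝓕 (fun x => F (tubePoint x y)) t =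
      Real.exp (2 * Real.pi * inner ℝ y' t) * 𝓕 (fun x => F (tubePoint x y')) t := by
  refine tendsto_nhds_unique (tendsto_integral_mul_dampedExp hi t) ?_
  refine (tendsto_integral_mul_dampedExp hi' t).congr fun k => ?_
  exact (integral_mul_dampedExp_eq hBc hF hb (by positivity) t hy hy').symm

/-! ### Exponential decay and Laplace integrals -/

theorem integrable_exp_neg_mul_norm {c : ℝ} (hc : 0 < c) :
    Integrable fun t : 𝔼 n => Real.exp (-c * ‖t‖) := by
  -- The exponent `n + 1` exceeds the dimension; one term of the exponential series gives the
  -- comparison.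
  have h := (integrable_one_add_norm (E := 𝔼 n) (μ := volume) (r := ((n + 1 : ℕ) : ℝ))
    (by simp)).const_mul (Real.exp c * (n + 1).factorial / c ^ (n + 1))
  refine h.mono' (by fun_prop) (ae_of_all _ fun t => ?_)
  have h1 := Real.pow_div_factorial_le_exp (c * (1 + ‖t‖)) (by positivity) (n + 1)
  have h2 : Real.exp (c * (1 + ‖t‖)) * Real.exp (-c * ‖t‖) = Real.exp c := by
    rw [← Real.exp_add]
    ring_nf
  rw [Real.norm_of_nonneg (Real.exp_pos _).le, Real.rpow_neg (by positivity), Real.rpow_natCast,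
    ← div_eq_mul_inv, div_div, le_div_iff₀ (by positivity), ← h2, ← mul_pow]
  rw [div_le_iff₀ (by positivity)] at h1
  nlinarith [mul_le_mul_of_nonneg_left h1 (Real.exp_pos (-c * ‖t‖)).le]

/-- If `f` is bounded by multiples of `exp (2 π y · t)` for `y` in a dense subset of an open set,
then it decays exponentially compared to `exp (2 π y₀ · t)` for all `y₀` in this set. -/
theorem exists_norm_le_exp_sub {B G : Set (𝔼 n)} (hB : IsOpen B)
    (hG : ∀ y₀ ∈ B, ∀ δ > 0, ∃ y ∈ G, dist y y₀ < δ) {f : (𝔼 n) → ℂ}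
    (hf : ∀ y ∈ G, ∃ C, ∀ t, ‖f t‖ ≤ C * Real.exp (2 * Real.pi * inner ℝ y t)) {y₀ : 𝔼 n}
    (hy₀ : y₀ ∈ B) :
    ∃ c > 0, ∃ C, ∀ t, ‖f t‖ ≤ C * Real.exp (2 * Real.pi * inner ℝ y₀ t - c * ‖t‖) := by
  obtain ⟨ρ, hρ, hρB⟩ := nhds_basis_closedBall.mem_iff.1 (hB.mem_nhds hy₀)
  have hρ2 : 0 < ρ / 2 := half_pos hρ
  choose! C hC using hf
  -- By compactness, finitely many points of `G` approximate the whole closed ball to within `ρ /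
  -- 2`, so one constant `K` serves for all directions of `t`.
  obtain ⟨T, hTG, hTf, hT⟩ := (isCompact_closedBall y₀ ρ).elim_finite_subcover_image
    (b := G) (c := fun y => ball y (ρ / 2)) (fun _ _ => isOpen_ball) (by
      intro w hw
      obtain ⟨y, hy, hyw⟩ := hG w (hρB hw) _ hρ2
      exact mem_iUnion₂.2 ⟨y, hy, by rwa [mem_ball, dist_comm]⟩)
  obtain ⟨K, hK⟩ := (hTf.image C).bddAbove
  refine ⟨Real.pi * ρ, by positivity, K, fun t => ?_⟩
  -- Moving by `ρ` against `t` lowers the inner product by `ρ ‖t‖`; approximating `w` from `T` gives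
  -- back at most half, leaving the rate `2π · ρ / 2`. For `t = 0` the division convention gives `w
  -- = y₀`.
  set w := y₀ - (ρ / ‖t‖) • t with hw
  have hwB : w ∈ closedBall y₀ ρ := by
    rw [mem_closedBall, dist_eq_norm, hw, sub_sub_cancel_left, norm_neg, norm_smul, norm_div,
      norm_norm, Real.norm_of_nonneg hρ.le]
    rcases eq_or_ne ‖t‖ 0 with ht | ht
    · simpa [ht] using hρ.le
    · rw [div_mul_cancel₀ _ ht]
  obtain ⟨y, hyT, hyw⟩ := mem_iUnion₂.1 (hT hwB)
  have hin : inner ℝ w t = inner ℝ y₀ t - ρ * ‖t‖ := by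
    rw [hw, inner_sub_left, inner_smul_left, real_inner_self_eq_norm_sq]
    rcases eq_or_ne t 0 with rfl | ht
    · simp
    · have : ‖t‖ ≠ 0 := norm_ne_zero_iff.2 ht
      simp
      field_simp
  have hyin : inner ℝ y t ≤ inner ℝ y₀ t - ρ / 2 * ‖t‖ := by
    have h1 : inner ℝ (y - w) t ≤ ρ / 2 * ‖t‖ := by
      refine (real_inner_le_norm _ _).trans (mul_le_mul_of_nonneg_right ?_ (norm_nonneg _))
      rw [← dist_eq_norm, dist_comm]
      exact (mem_ball.1 hyw).le
    rw [inner_sub_left, hin] at h1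
    linarith
  have hyK : C y ≤ K := hK (mem_image_of_mem _ hyT)
  have hCy : 0 ≤ C y := by
    have := (norm_nonneg _).trans (hC y (hTG hyT) 0)
    simpa using this
  refine (hC y (hTG hyT) t).trans ?_
  have hexp : 2 * Real.pi * inner ℝ y t ≤ 2 * Real.pi * inner ℝ y₀ t - Real.pi * ρ * ‖t‖ := by
    nlinarith [Real.pi_pos]
  have : 0 ≤ K := hCy.trans hyK
  gcongr

theorem norm_exp_bilin (t x y : 𝔼 n) :
    ‖Complex.exp (2 * Real.pi * Complex.I * bilin t (tubePoint x y))‖ =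
      Real.exp (-2 * Real.pi * inner ℝ y t) := by
  rw [Complex.norm_exp, bilin_tubePoint]
  congr 1
  simp

theorem continuous_exp_bilin (x y : 𝔼 n) :
    Continuous fun t => Complex.exp (2 * Real.pi * Complex.I * bilin t (tubePoint x y)) := by
  simp only [bilin_tubePoint]
  fun_prop

/-- Half of the decay rate at `y₀` pays for moving to a nearby `y`, so the majorant is common to a
neighbourhood of `y₀`. -/
theorem norm_mul_exp_le {c C : ℝ} {y₀ y t : 𝔼 n} {a : ℂ}
    (ha : ‖a‖ ≤ C * Real.exp (2 * Real.pi * inner ℝ y₀ t - c * ‖t‖))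
    (hy : 2 * Real.pi * ‖y - y₀‖ ≤ c / 2) :
    ‖a‖ * Real.exp (-2 * Real.pi * inner ℝ y t) ≤ C * Real.exp (-(c / 2) * ‖t‖) := by
  have hC : 0 ≤ C := by
    by_contra! h
    exact absurd ((norm_nonneg _).trans ha) (not_le.2 (mul_neg_of_neg_of_pos h (Real.exp_pos _)))
  calc ‖a‖ * Real.exp (-2 * Real.pi * inner ℝ y t)
      ≤ C * Real.exp (2 * Real.pi * inner ℝ y₀ t - c * ‖t‖) *
        Real.exp (-2 * Real.pi * inner ℝ y t) := by gcongr
    _ ≤ _ := by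
      rw [mul_assoc, ← Real.exp_add]
      refine mul_le_mul_of_nonneg_left (Real.exp_le_exp.2 ?_) hC
      have h1 := neg_le_of_abs_le (abs_real_inner_le_norm (y - y₀) t)
      rw [inner_sub_left] at h1
      nlinarith [mul_le_mul_of_nonneg_right hy (norm_nonneg t), Real.pi_pos]

theorem integrable_mul_exp {B : Set (𝔼 n)} {f : (𝔼 n) → ℂ} (hfc : Continuous f)
    (hf : ∀ y₀ ∈ B, ∃ c > 0, ∃ C, ∀ t, ‖f t‖ ≤
      C * Real.exp (2 * Real.pi * inner ℝ y₀ t - c * ‖t‖)) {y : 𝔼 n} (hy : y ∈ B) :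
    Integrable fun t => f t * (Real.exp (-2 * Real.pi * inner ℝ y t) : ℂ) := by
  obtain ⟨c, hc, C, hC⟩ := hf y hy
  refine ((integrable_exp_neg_mul_norm (half_pos hc)).const_mul C).mono'
    (Continuous.aestronglyMeasurable (by fun_prop)) (ae_of_all _ fun t => ?_)
  rw [norm_mul, Complex.norm_real, Real.norm_of_nonneg (Real.exp_pos _).le]
  exact norm_mul_exp_le (hC t) (by simpa using (half_pos hc).le)

theorem continuousOn_integral_mul_exp {B : Set (𝔼 n)} {f : (𝔼 n) → ℂ} (hfc : Continuous f)
    (hf : ∀ y₀ ∈ B, ∃ c > 0, ∃ C, ∀ t, ‖f t‖ ≤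
      C * Real.exp (2 * Real.pi * inner ℝ y₀ t - c * ‖t‖)) (x : 𝔼 n) :
    ContinuousOn (fun y => ∫ t, f t *
      Complex.exp (2 * Real.pi * Complex.I * bilin t (tubePoint x y))) B := by
  intro y₀ hy₀
  apply ContinuousAt.continuousWithinAt
  obtain ⟨c, hc, C, hC⟩ := hf y₀ hy₀
  refine continuousAt_of_dominated (bound := fun t => C * Real.exp (-(c / 2) * ‖t‖))
    (Eventually.of_forall fun y =>
      (hfc.mul (continuous_exp_bilin x y)).aestronglyMeasurable) ?_
    ((integrable_exp_neg_mul_norm (half_pos hc)).const_mul C) ?_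
  · have hr : 0 < c / 2 / (2 * Real.pi) := by positivity
    filter_upwards [ball_mem_nhds y₀ hr] with y hy
    refine ae_of_all _ fun t => ?_
    rw [norm_mul, norm_exp_bilin]
    refine norm_mul_exp_le (hC t) ?_
    have := (mem_ball_iff_norm.1 hy).le
    rwa [le_div_iff₀' Real.two_pi_pos] at this
  · refine ae_of_all _ fun t => Continuous.continuousAt ?_
    simp only [bilin_tubePoint]
    fun_prop

/-! ### The Laplace representation -/

theorem locallyBoundedOnTube_of_lintegral_rpow_lt_top {B : Set (𝔼 n)} (hB : IsOpen B)
    {F : EuclideanSpace ℂ (Fin n) → ℂ} (hF : DifferentiableOn ℂ F (tube B)) {p σ : ℝ} (hp : 0 < p)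
    (hσ : 0 < σ) (hσ1 : σ ≤ 1) (h : ∀ y₀ ∈ B, ∃ r > 0, ball y₀ r ⊆ B ∧
      ∫⁻ y in ball y₀ r, (∫⁻ x, ‖F (tubePoint x y)‖ₑ ^ p) ^ σ < ∞) :
    LocallyBoundedOnTube B F := by
  intro y₀ hy₀
  obtain ⟨r, hr, hrB, hI⟩ := h y₀ hy₀
  exact ⟨r / 2, half_pos hr, (ball_subset_ball (by linarith)).trans hrB,
    exists_norm_le_of_lintegral_rpow_lt_top hB hF hp hσ hσ1 hr hrB hI⟩

theorem exists_laplace_representation {B : Set (𝔼 n)} (hBo : IsOpen B) (hBc : IsConnected B)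
    {F : EuclideanSpace ℂ (Fin n) → ℂ} (hF : DifferentiableOn ℂ F (tube B))
    (hb : LocallyBoundedOnTube B F)
    (hd : ∀ y₀ ∈ B, ∀ δ > 0, ∃ y ∈ B, dist y y₀ < δ ∧ Integrable fun x => F (tubePoint x y)) :
    ∃ f : (𝔼 n) → ℂ, Continuous f ∧
      (∀ y ∈ B, Integrable fun t => f t * (Real.exp (-2 * Real.pi * inner ℝ y t) : ℂ)) ∧
      ∀ z ∈ tube B, F z = ∫ t, f t * Complex.exp (2 * Real.pi * Complex.I * bilin t z) := by
  let G : Set (𝔼 n) := {y ∈ B | Integrable fun x => F (tubePoint x y)}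
  have hG : ∀ y₀ ∈ B, ∀ δ > 0, ∃ y ∈ G, dist y y₀ < δ := fun y₀ hy₀ δ hδ => by
    obtain ⟨y, hy, hyδ, hi⟩ := hd y₀ hy₀ δ hδ
    exact ⟨y, ⟨hy, hi⟩, hyδ⟩
  obtain ⟨b, hbB⟩ := hBc.nonempty
  obtain ⟨y₁, hy₁, -⟩ := hG b hbB 1 one_pos
  let f : (𝔼 n) → ℂ := fun t =>
    (Real.exp (2 * Real.pi * inner ℝ y₁ t) : ℂ) * 𝓕 (fun x => F (tubePoint x y₁)) t
  have hfy : ∀ y ∈ G, ∀ t,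
      f t = (Real.exp (2 * Real.pi * inner ℝ y t) : ℂ) * 𝓕 (fun x => F (tubePoint x y)) t :=
    fun y hy t => exp_mul_fourier_eq hBc.isPreconnected hF hb hy₁.1 hy.1 hy₁.2 hy.2 t
  have hfc : Continuous f := by
    have h1 : Continuous (𝓕 (fun x => F (tubePoint x y₁))) :=
      VectorFourier.fourierIntegral_continuous Real.continuous_fourierChar
        (by exact continuous_inner) hy₁.2
    exact Continuous.mul (by fun_prop) h1
  have hbd : ∀ y ∈ G, ∃ C, ∀ t, ‖f t‖ ≤ C * Real.exp (2 * Real.pi * inner ℝ y t) := by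
    intro y hy
    refine ⟨∫ x, ‖F (tubePoint x y)‖, fun t => ?_⟩
    rw [hfy y hy, norm_mul, mul_comm, Complex.norm_real, Real.norm_of_nonneg (Real.exp_pos _).le]
    refine mul_le_mul_of_nonneg_right ?_ (Real.exp_pos _).le
    exact VectorFourier.norm_fourierIntegral_le_integral_norm _ _ _ _ _
  have hdecay : ∀ y₀ ∈ B, ∃ c > 0, ∃ C, ∀ t, ‖f t‖ ≤
      C * Real.exp (2 * Real.pi * inner ℝ y₀ t - c * ‖t‖) :=
    fun y₀ hy₀ => exists_norm_le_exp_sub hBo hG hbd hy₀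
  refine ⟨f, hfc, fun y hy => integrable_mul_exp hfc hdecay hy, ?_⟩
  have hgood : ∀ y ∈ G, ∀ x, F (tubePoint x y) =
      ∫ t, f t * Complex.exp (2 * Real.pi * Complex.I * bilin t (tubePoint x y)) := by
    intro y hy x
    have hexp : ∀ t, 𝓕 (fun x => F (tubePoint x y)) t =
        f t * (Real.exp (-2 * Real.pi * inner ℝ y t) : ℂ) := by
      intro t
      rw [hfy y hy, mul_right_comm, ← Complex.ofReal_mul, ← Real.exp_add]
      simp
    -- The exponential decay makes the Fourier transform integrable, as inversion requires;
    -- continuity of the slice makes inversion hold at every `x`.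
    have hi : Integrable (𝓕 (fun x => F (tubePoint x y))) :=
      (integrable_mul_exp hfc hdecay hy.1).congr (ae_of_all _ fun t => (hexp t).symm)
    have hcont := continuous_tubePoint_left hF.continuousOn hy.1
    have hinv := congrFun (hcont.fourierInv_fourier_eq hy.2 hi) x
    rw [← hinv, Real.fourierInv_eq']
    congr 1
    ext t
    rw [hexp, bilin_tubePoint, smul_eq_mul, mul_comm, mul_assoc, Complex.ofReal_exp,
      ← Complex.exp_add, real_inner_comm x t]
    congr 2
    push_cast
    linear_combination (-2 * (Real.pi : ℂ) * (inner ℝ y t : ℝ)) * Complex.I_sq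
  intro z hz
  obtain ⟨x, hx⟩ := exists_tubePoint_eq z
  have hy : imPart z ∈ B := hz
  rw [← hx]
  generalize imPart z = y at hy
  -- Both sides are continuous in `y ∈ B` for fixed `x` and agree on the dense set `G`.
  have hcl : y ∈ closure G := Metric.mem_closure_iff.2 fun δ hδ => by
    obtain ⟨y', hy', h⟩ := hG y hy δ hδ
    exact ⟨y', hy', by rwa [dist_comm]⟩
  have hFc : ContinuousOn (fun y => F (tubePoint x y)) B :=
    hF.continuousOn.comp (continuous_tubePoint.comp
      (by fun_prop : Continuous fun y => (x, y))).continuousOn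
      fun y hy => tubePoint_mem_tube.2 hy
  have hGc := continuousOn_integral_mul_exp hfc hdecay x
  have : (𝓝[G] y).NeBot := mem_closure_iff_nhdsWithin_neBot.1 hcl
  have hGB : 𝓝[G] y ≤ 𝓝[B] y := nhdsWithin_mono _ fun y hy => hy.1
  refine tendsto_nhds_unique ((hFc y hy).mono_left hGB) (((hGc y hy).mono_left hGB).congr' ?_)
  filter_upwards [self_mem_nhdsWithin] with y' hy'
  exact (hgood y' hy' x).symm

end TubeBergman

theorem theorem2 {n : ℕ} (B : Set (EuclideanSpace ℝ (Fin n))) (hBo : IsOpen B)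
    (hBc : IsConnected B) (ψ : EuclideanSpace ℝ (Fin n) → ℝ) (hψ : ContinuousOn ψ B)
    (p : ℝ) (hp0 : 0 < p) (hp1 : p < 1) (s : ℝ≥0∞) (hs : 0 < s)
    (F : EuclideanSpace ℂ (Fin n) → ℂ) (hF : F ∈ TubeBergman.bergmanSpace B ψ p s) :
    ∃ f : EuclideanSpace ℝ (Fin n) → ℂ, Continuous f ∧
      (∀ y ∈ B, Integrable
        (fun t => f t * (Real.exp (-2 * Real.pi * inner ℝ y t) : ℂ)) volume) ∧
      ∀ z ∈ TubeBergman.tube B,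
        F z = ∫ t, f t * Complex.exp (2 * Real.pi * Complex.I * TubeBergman.bilin t z) := by
  obtain ⟨hFd, hFn⟩ := hF
  obtain ⟨σ, hσ, hσ1, hloc⟩ := TubeBergman.exists_lintegral_rpow_lt_top hBo hψ hp0 hs hFn
  have hb := TubeBergman.locallyBoundedOnTube_of_lintegral_rpow_lt_top hBo hFd hp0 hσ hσ1 hloc
  refine TubeBergman.exists_laplace_representation hBo hBc hFd hb fun y₀ hy₀ δ hδ => ?_
  obtain ⟨r, hr, hrB, hI⟩ := hloc y₀ hy₀
  obtain ⟨y, hyr, hyδ, hfin⟩ := TubeBergman.exists_mem_ball_lt_top hσ hI hδ hr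
  have hy := hrB hyr
  refine ⟨y, hy, hyδ, ?_⟩
  obtain ⟨r', hr', -, M, hM⟩ := hb y hy
  exact TubeBergman.integrable_of_norm_le
    (TubeBergman.continuous_tubePoint_left hFd.continuousOn hy).aestronglyMeasurable hp0 hp1.le
    (fun x => hM x y (Metric.mem_ball_self hr')) hfin
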